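/- Consider two deterministic linear systems \[ \Sigma_i:\quad \dot x_i=A_ix_i+B_iu_i,\qquad y_i=C_ix_i,\qquad i=1,2, \] with states $x_i\in\mathbb{R}^{n_i}$, inputs $u_i\in\mathbb{R}^m$, outputs $y_i\in\mathbb{R}^p$, real matrices $A_i,B_i,C_i$, and each $A_i$ Hurwitz (all eigenvalues have negative real part). Let $\mathcal L_2$ be the space of square-integrable signals on $[0,\infty)$, with norm $\|u\|=(\int_0^\infty|u(t)|^2\,dt)^{1/2}$. For $\gamma,\delta>0$, $\Sigma_2$ is said to be $(\gamma,\delta)$-similar to $\Sigma_1$, written $\Sigma_1\preccurlyeq_{\gamma,\delta}\Sigma_2$, if there is a constant $\varepsilon>0$ such that for all $u_1,u_2\in\mathcal L_2$ \[ \|y_1-y_2\|^2\le\gamma\|u_1-u_2\|^2+(\delta-\varepsilon)\left\|\begin{bmatrix}u_1\\u_2\end{bmatrix}\right\|^2, \] where $y_i$ is the output of $\Sigma_i$ for the initial state $x_i(0)=0$ and the input $u_i$. Let $G_i(s)=C_i(sI-A_i)^{-1}B_i$ be the transfer matrix of $\Sigma_i$, and for a matrix function $G$ let $\|G\|_\infty=\sup_{\omega\in\mathbb{R}}\sigma_{\max}(G(\mathrm{i}\omega))$,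 where $\sigma_{\max}$ is the largest singular value. **Proposition.** Let $\gamma,\delta>0$. Then $\Sigma_1\preccurlyeq_{\gamma,\delta}\Sigma_2$ if and only if $\Sigma_2\preccurlyeq_{\gamma,\delta}\Sigma_1$, and in this case (a) $\|G_i\|_\infty<(\gamma+\delta)^{1/2}$ for $i=1,2$; (b) $\|G_1-G_2\|_\infty<(2\delta)^{1/2}$. -/

import Mathlib

open MeasureTheory

noncomputable section

/-- A deterministic continuous-time linear system `x' = A x + B u`, `y = C x`, with `n` states,
`m` inputs and `p` outputs. -/
structure LinearSystem (n m p : ℕ) where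
  A : Matrix (Fin n) (Fin n) ℝ
  B : Matrix (Fin n) (Fin m) ℝ
  C : Matrix (Fin p) (Fin n) ℝ

/-- A real square matrix is Hurwitz if all its complex eigenvalues have negative real part. -/
def IsHurwitz {n : ℕ} (A : Matrix (Fin n) (Fin n) ℝ) : Prop :=
  ∀ z ∈ spectrum ℂ (A.map (fun a : ℝ => (a : ℂ))), z.re < 0

/-- The space `𝓛₂` of signals on `[0, ∞)`. Signals are functions on `ℝ` of which only the values
on `[0, ∞)` matter. -/
def IsL2Signal {k : ℕ} (u : ℝ → EuclideanSpace ℝ (Fin k)) : Prop :=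
  MemLp u 2 (volume.restrict (Set.Ici (0 : ℝ)))

/-- The `𝓛₂` norm of a signal on `[0, ∞)`. -/
def l2Norm {ι : Type*} [Fintype ι] (u : ℝ → EuclideanSpace ℝ ι) : ℝ :=
  √(∫ t in Set.Ici (0 : ℝ), ‖u t‖ ^ 2)

/-- The stacked signal `col(u₁, u₂)`. -/
def colSignal {k l : ℕ} (u₁ : ℝ → EuclideanSpace ℝ (Fin k)) (u₂ : ℝ → EuclideanSpace ℝ (Fin l)) :
    ℝ → EuclideanSpace ℝ (Fin k ⊕ Fin l) :=
  fun t => WithLp.toLp 2 (Sum.elim (fun i => u₁ t i) (fun i => u₂ t i))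

namespace LinearSystem

variable {n m p : ℕ}

/-- `x` is the state trajectory on `[0, ∞)` (in the sense of Carathéodory, so in integrated form)
for the initial condition `x(0) = x₀` and the input `u`. -/
def IsStateTrajectory (S : LinearSystem n m p) (x₀ : EuclideanSpace ℝ (Fin n))
    (u : ℝ → EuclideanSpace ℝ (Fin m)) (x : ℝ → EuclideanSpace ℝ (Fin n)) : Prop :=
  ContinuousOn x (Set.Ici 0) ∧
    ∀ t : ℝ, 0 ≤ t →
      x t = x₀ + ∫ s in (0 : ℝ)..t,
        (Matrix.toEuclideanLin S.A (x s) + Matrix.toEuclideanLin S.B (u s))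

/-- `y` is (on `[0, ∞)`) the output solution `y(·; 0, x₀, u)`. -/
def IsOutput (S : LinearSystem n m p) (x₀ : EuclideanSpace ℝ (Fin n))
    (u : ℝ → EuclideanSpace ℝ (Fin m)) (y : ℝ → EuclideanSpace ℝ (Fin p)) : Prop :=
  ∃ x, S.IsStateTrajectory x₀ u x ∧ ∀ t : ℝ, 0 ≤ t → y t = Matrix.toEuclideanLin S.C (x t)

/-- The transfer matrix `G(s) = C (s I - A)⁻¹ B`. -/
def transferMatrix (S : LinearSystem n m p) (s : ℂ) : Matrix (Fin p) (Fin m) ℂ :=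
  S.C.map (fun a : ℝ => (a : ℂ)) *
    (s • (1 : Matrix (Fin n) (Fin n) ℂ) - S.A.map (fun a : ℝ => (a : ℂ)))⁻¹ *
      S.B.map (fun a : ℝ => (a : ℂ))

end LinearSystem

/-- `S₂` is `(γ, δ)`-similar to `S₁` (both deterministic): for some `ε > 0` and all inputs
`u₁, u₂ ∈ 𝓛₂`, the zero-state outputs satisfy
`‖y₁ - y₂‖² ≤ γ ‖u₁ - u₂‖² + (δ - ε) ‖col(u₁, u₂)‖²`. The finiteness of the left-hand side, which
the inequality expresses, is written out since the integral in `l2Norm` is `0` otherwise. -/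
def IsSimilar {n₁ n₂ m p : ℕ} (γ δ : ℝ) (S₁ : LinearSystem n₁ m p) (S₂ : LinearSystem n₂ m p) :
    Prop :=
  ∃ ε : ℝ, 0 < ε ∧
    ∀ u₁ u₂ : ℝ → EuclideanSpace ℝ (Fin m), IsL2Signal u₁ → IsL2Signal u₂ →
      ∀ y₁ y₂ : ℝ → EuclideanSpace ℝ (Fin p), S₁.IsOutput 0 u₁ y₁ → S₂.IsOutput 0 u₂ y₂ →
        IsL2Signal (y₁ - y₂) ∧
          l2Norm (y₁ - y₂) ^ 2 ≤
            γ * l2Norm (u₁ - u₂) ^ 2 + (δ - ε) * l2Norm (colSignal u₁ u₂) ^ 2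

/-- The largest singular value of a complex matrix (Mathlib lists the singular values of a linear
map in decreasing order, followed by zeros). -/
def sigmaMax {p m : ℕ} (M : Matrix (Fin p) (Fin m) ℂ) : ℝ :=
  (Matrix.toEuclideanLin M).singularValues 0

/-- The `H_∞` norm `sup_ω σ_max (G (i ω))`, as an extended nonnegative real. -/
def hInfNorm {p m : ℕ} (G : ℂ → Matrix (Fin p) (Fin m) ℂ) : ENNReal :=
  ⨆ ω : ℝ, ENNReal.ofReal (sigmaMax (G (Complex.I * (ω : ℂ))))

end

/-!
Symmetry of similarity is immediate, since `‖y₁ - y₂‖`, `‖u₁ - u₂‖` and `‖col(u₁, u₂)‖` do not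
change when the two systems are exchanged. For the bounds, `u₂ = 0` turns the similarity inequality
into `‖y₁‖² ≤ (γ + δ - ε) ‖u₁‖²`, and `u₁ = u₂ = u` turns it into `‖y₁ - y₂‖² ≤ 2 (δ - ε) ‖u‖²`.
It remains to see that an `𝓛₂` gain bound with constant `c` implies `‖G‖_∞ ≤ √c`; strictness then
comes from `ε > 0`.

This is done in the time domain, without Plancherel's theorem. For `s = iω - θ²` with small `θ > 0`
the input `e^{st} v` is in `𝓛₂` with energy `‖v‖² / (2θ²)`, and the zero-state output is
`e^{st} G(s) v - C e^{tA} ξ` with `ξ = (s I - A)⁻¹ B v` (`LinearSystem.isOutput_reVec_exp`; real and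
imaginary parts are treated as separate real signals). The transient `C e^{tA} ξ` has energy bounded
independently of `θ`, because `e^{tA}` is square-integrable on `[0, ∞)` for Hurwitz `A`
(`memLp_two_exp_smul`, by generalized eigenspaces) and `ξ` depends continuously on `s`. The gain
bound, multiplied by `2θ²`, becomes `‖G(iω) v‖² ≤ c ‖v‖²` as `θ → 0` (`hInfNorm_le_of_gain`), and
this bounds the largest singular value of `G(iω)` (`singularValues_zero_le`).
-/

open Filter Topology

/-! ### The exponential of a Hurwitz operator is square-integrable -/

/-- On a generalized eigenvector, `e^{ta}` is `e^{μt}` times a polynomial in `t`. -/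
theorem exp_smul_apply_of_pow_apply_eq_zero {E : Type*} [NormedAddCommGroup E] [NormedSpace ℂ E]
    [CompleteSpace E] (a : E →L[ℂ] E) (μ : ℂ) (k : ℕ) (x : E)
    (hx : ((a - algebraMap ℂ (E →L[ℂ] E) μ) ^ k) x = 0) (t : ℝ) :
    NormedSpace.exp ((t : ℂ) • a) x = Complex.exp (μ * t) •
      ∑ j ∈ Finset.range k, ((j.factorial : ℂ)⁻¹ * (t : ℂ) ^ j) •
        ((a - algebraMap ℂ (E →L[ℂ] E) μ) ^ j) x := by
  let _ : NormedAlgebra ℚ (E →L[ℂ] E) := NormedAlgebra.restrictScalars ℚ ℂ _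
  set N := a - algebraMap ℂ (E →L[ℂ] E) μ with hN
  have hsplit : (t : ℂ) • a = algebraMap ℂ (E →L[ℂ] E) (μ * t) + (t : ℂ) • N := by
    rw [hN, smul_sub, Algebra.algebraMap_eq_smul_one, Algebra.algebraMap_eq_smul_one, smul_smul,
      mul_comm]
    abel
  have hexp : NormedSpace.exp ((t : ℂ) • a) =
      Complex.exp (μ * t) • NormedSpace.exp ((t : ℂ) • N) := by
    rw [hsplit, NormedSpace.exp_add_of_commute (Algebra.commutes _ _),
      ← NormedSpace.algebraMap_exp_comm, ← Algebra.smul_def, Complex.exp_eq_exp_ℂ]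
  have hsum : HasSum (fun j : ℕ => ((j.factorial : ℂ)⁻¹ • ((t : ℂ) • N) ^ j) x)
      (NormedSpace.exp ((t : ℂ) • N) x) :=
    (NormedSpace.exp_series_hasSum_exp' (𝕂 := ℂ) ((t : ℂ) • N)).mapL
      (ContinuousLinearMap.apply ℂ E x)
  have hzero : ∀ j ∉ Finset.range k, ((j.factorial : ℂ)⁻¹ • ((t : ℂ) • N) ^ j) x = 0 := by
    intro j hj
    obtain ⟨i, rfl⟩ := Nat.exists_eq_add_of_le (not_lt.mp (by simpa using hj))
    rw [smul_pow, add_comm k i, pow_add N]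
    simp [hx]
  rw [hexp, smul_apply, hsum.unique (hasSum_sum_of_ne_finset_zero hzero)]
  congr 1
  refine Finset.sum_congr rfl fun j _ => ?_
  rw [smul_pow, smul_smul, smul_apply]

theorem memLp_two_pow_mul_exp {μ : ℂ} (hμ : μ.re < 0) (j : ℕ) :
    MemLp (fun t : ℝ => Complex.exp (μ * t) * (t : ℂ) ^ j) 2
      (volume.restrict (Set.Ici (0 : ℝ))) := by
  have hc : Continuous fun t : ℝ => Complex.exp (μ * t) * (t : ℂ) ^ j := by fun_prop
  rw [memLp_two_iff_integrable_sq_norm hc.aestronglyMeasurable]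
  refine (integrableOn_Ici_iff_integrableOn_Ioi).mpr
    (integrable_of_isBigO_exp_neg (b := -μ.re) (by linarith) (by fun_prop) ?_)
  have h := (isLittleO_pow_exp_pos_mul_atTop (2 * j) (b := -μ.re) (by linarith)).isBigO
  have h2 := (Asymptotics.isBigO_refl (fun t : ℝ => Real.exp (2 * μ.re * t)) Filter.atTop).mul h
  refine h2.congr (fun t => ?_) (fun t => ?_)
  · rw [norm_mul, mul_pow, Complex.norm_exp, norm_pow, Complex.norm_real, ← pow_mul,
      mul_comm j 2, pow_mul ‖t‖, Real.norm_eq_abs, sq_abs, ← pow_mul, ← Real.exp_nat_mul]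
    congr 2
    simp; ring
  · rw [← Real.exp_add]; congr 1; ring

theorem hasDerivAt_exp_ofReal_smul_apply {E : Type*} [NormedAddCommGroup E] [NormedSpace ℂ E]
    [CompleteSpace E] [NormedSpace ℝ E] [IsScalarTower ℝ ℂ E] (a : E →L[ℂ] E) (x : E) (t : ℝ) :
    HasDerivAt (fun t : ℝ => NormedSpace.exp ((t : ℂ) • a) x)
      (a (NormedSpace.exp ((t : ℂ) • a) x)) t := by
  have h : HasDerivAt (fun z : ℂ => NormedSpace.exp (z • a) x)
      (a (NormedSpace.exp ((t : ℂ) • a) x)) (t : ℂ) :=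
    (ContinuousLinearMap.apply ℂ E x).hasFDerivAt.comp_hasDerivAt (t : ℂ)
      (hasDerivAt_exp_smul_const' a (t : ℂ))
  simpa using! h.scomp t Complex.ofRealCLM.hasDerivAt

theorem continuous_exp_ofReal_smul {E : Type*} [NormedAddCommGroup E] [NormedSpace ℂ E]
    [CompleteSpace E] (a : E →L[ℂ] E) :
    Continuous fun t : ℝ => NormedSpace.exp ((t : ℂ) • a) := by
  have h : Continuous fun z : ℂ => NormedSpace.exp (z • a) :=
    continuous_iff_continuousAt.mpr fun z => (hasDerivAt_exp_smul_const a z).continuousAt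
  exact h.comp Complex.continuous_ofReal

theorem memLp_two_exp_smul_apply {E : Type*} [NormedAddCommGroup E] [NormedSpace ℂ E]
    [FiniteDimensional ℂ E] (a : E →L[ℂ] E)
    (ha : ∀ μ : ℂ, Module.End.HasEigenvalue (a : Module.End ℂ E) μ → μ.re < 0) (x : E) :
    MemLp (fun t : ℝ => NormedSpace.exp ((t : ℂ) • a) x) 2 (volume.restrict (Set.Ici (0 : ℝ))) := by
  have : CompleteSpace E := FiniteDimensional.complete ℂ E
  let V : Submodule ℂ E :=
    { carrier := {x | MemLp (fun t : ℝ => NormedSpace.exp ((t : ℂ) • a) x) 2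
        (volume.restrict (Set.Ici (0 : ℝ)))}
      add_mem' := fun {x y} hx hy => by
        simp only [Set.mem_ofPred_eq, map_add] at hx hy ⊢
        exact hx.add hy
      zero_mem' := by simp
      smul_mem' := fun c x hx => by
        simp only [Set.mem_ofPred_eq, map_smul] at hx ⊢
        exact hx.const_smul c }
  -- the generalized eigenspaces lie in `V`, and they span `E`
  have hV : ⨆ μ : ℂ, Module.End.maxGenEigenspace (a : Module.End ℂ E) μ ≤ V := by
    refine iSup_le fun μ y hy => ?_
    obtain ⟨k, hk⟩ := Module.End.mem_maxGenEigenspace _ _ _ |>.mp hy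
    by_cases hμ : μ.re < 0
    · have hk' : ((a - algebraMap ℂ (E →L[ℂ] E) μ) ^ k) y = 0 := by
        rw [← hk]
        have : ((a : Module.End ℂ E) - μ • 1) =
          ((a - algebraMap ℂ (E →L[ℂ] E) μ : E →L[ℂ] E) : Module.End ℂ E) := by
          ext z; simp [Algebra.algebraMap_eq_smul_one]
        rw [this, ← ContinuousLinearMap.toLinearMap_pow]
        rfl
      change MemLp _ _ _
      simp_rw [exp_smul_apply_of_pow_apply_eq_zero a μ k y hk', Finset.smul_sum]
      refine memLp_finsetSum _ fun j _ => ?_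
      have h := ((memLp_two_pow_mul_exp hμ j).const_mul ((j.factorial : ℂ)⁻¹))
      refine (ContinuousLinearMap.comp_memLp' (ContinuousLinearMap.toSpanSingleton ℂ
        (((a - algebraMap ℂ (E →L[ℂ] E) μ) ^ j) y)) h).ae_eq (Filter.Eventually.of_forall ?_)
      intro t
      simp [smul_smul]
      congr 1
      ring
    · have hne : ¬ Module.End.HasEigenvalue (a : Module.End ℂ E) μ := fun h => hμ (ha μ h)
      have : Module.End.maxGenEigenspace (a : Module.End ℂ E) μ = ⊥ := by
        by_contra h
        exact hne ((Module.End.hasUnifEigenvalue_iff_hasUnifEigenvalue_one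
          (k := ⊤) (by simp)).mp h)
      rw [this, Submodule.mem_bot] at hy
      rw [hy]; exact V.zero_mem
  rw [Module.End.iSup_maxGenEigenspace_eq_top] at hV
  exact hV Submodule.mem_top

theorem memLp_two_exp_smul {E : Type*} [NormedAddCommGroup E] [NormedSpace ℂ E]
    [FiniteDimensional ℂ E] (a : E →L[ℂ] E)
    (ha : ∀ μ : ℂ, Module.End.HasEigenvalue (a : Module.End ℂ E) μ → μ.re < 0) :
    MemLp (fun t : ℝ => NormedSpace.exp ((t : ℂ) • a)) 2 (volume.restrict (Set.Ici (0 : ℝ))) := by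
  have : CompleteSpace E := FiniteDimensional.complete ℂ E
  let b := Module.finBasis ℂ E
  obtain ⟨C, -, hC⟩ := b.exists_opNorm_le (F := E)
  have hsum : MemLp (fun t : ℝ => C * ∑ i, ‖NormedSpace.exp ((t : ℂ) • a) (b i)‖) 2
      (volume.restrict (Set.Ici (0 : ℝ))) :=
    (memLp_finsetSum _ fun i _ => (memLp_two_exp_smul_apply a ha (b i)).norm).const_mul C
  refine hsum.mono (continuous_exp_ofReal_smul a).aestronglyMeasurable
    (Eventually.of_forall fun t => ?_)
  refine (hC (Finset.sum_nonneg fun i _ => norm_nonneg _) fun i =>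
    Finset.single_le_sum (f := fun i => ‖NormedSpace.exp ((t : ℂ) • a) (b i)‖)
      (fun i _ => norm_nonneg _) (Finset.mem_univ i)).trans (le_abs_self _)

/-! ### The largest singular value -/

theorem singularValues_zero_le {E F : Type*} [NormedAddCommGroup E] [InnerProductSpace ℂ E]
    [FiniteDimensional ℂ E] [NormedAddCommGroup F] [InnerProductSpace ℂ F]
    [FiniteDimensional ℂ F] (T : E →ₗ[ℂ] F) {c : ℝ}
    (h : ∀ v, ‖T v‖ ^ 2 ≤ c * ‖v‖ ^ 2) : T.singularValues 0 ≤ √c := by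
  by_cases hn : 0 < Module.finrank ℂ E
  -- a right singular vector for the largest singular value attains the bound
  · obtain ⟨v, hv⟩ := (T.hasEigenvalue_adjoint_comp_self_sq_singularValues hn).exists_hasEigenvector
    have hv0 : 0 < ‖v‖ ^ 2 := by have := norm_pos_iff.mpr hv.2; positivity
    have key : ‖T v‖ ^ 2 = T.singularValues 0 ^ 2 * ‖v‖ ^ 2 := by
      have h1 := congrArg (fun z => (inner ℂ v z)) hv.apply_eq_smul
      simp only [LinearMap.comp_apply, LinearMap.adjoint_inner_right, inner_smul_right,
        inner_self_eq_norm_sq_to_K] at h1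
      exact_mod_cast h1
    refine Real.le_sqrt_of_sq_le ?_
    have := h v
    rw [key] at this
    exact le_of_mul_le_mul_right this hv0
  -- on the zero space all singular values are zero
  · rw [T.singularValues_of_finrank_le (by omega)]
    exact Real.sqrt_nonneg _

/-! ### Real parts of complex signals and symmetry of similarity -/

/-- The componentwise real part of a complex vector, as a continuous real-linear map. -/
noncomputable def reVec (k : ℕ) : EuclideanSpace ℂ (Fin k) →L[ℝ] EuclideanSpace ℝ (Fin k) :=
  LinearMap.toContinuousLinearMap
    { toFun := fun z => WithLp.toLp 2 fun i => (z i).re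
      map_add' := fun z w => by ext i; simp
      map_smul' := fun c z => by ext i; simp }

@[simp]
theorem reVec_apply {k : ℕ} (z : EuclideanSpace ℂ (Fin k)) (i : Fin k) :
    reVec k z i = (z i).re := rfl

/-- Multiplication by `-i` turns the imaginary part into the real part. -/
theorem norm_sq_eq_reVec {k : ℕ} (z : EuclideanSpace ℂ (Fin k)) :
    ‖z‖ ^ 2 = ‖reVec k z‖ ^ 2 + ‖reVec k ((-Complex.I) • z)‖ ^ 2 := by
  rw [EuclideanSpace.norm_sq_eq, EuclideanSpace.norm_sq_eq, EuclideanSpace.norm_sq_eq,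
    ← Finset.sum_add_distrib]
  refine Finset.sum_congr rfl fun i _ => ?_
  rw [Complex.sq_norm, Complex.normSq_apply]
  simp [sq]

theorem reVec_toEuclideanLin {k l : ℕ} (M : Matrix (Fin k) (Fin l) ℝ)
    (z : EuclideanSpace ℂ (Fin l)) :
    reVec k (Matrix.toEuclideanLin (M.map (fun a : ℝ => (a : ℂ))) z) =
      Matrix.toEuclideanLin M (reVec l z) := by
  ext i
  simp [Matrix.mulVec, dotProduct]

theorem sq_l2Norm {ι : Type*} [Fintype ι] (u : ℝ → EuclideanSpace ℝ ι) :
    l2Norm u ^ 2 = ∫ t in Set.Ici (0 : ℝ), ‖u t‖ ^ 2 :=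
  Real.sq_sqrt (integral_nonneg fun _ => by positivity)

theorem norm_sq_colSignal {k l : ℕ} (u₁ : ℝ → EuclideanSpace ℝ (Fin k))
    (u₂ : ℝ → EuclideanSpace ℝ (Fin l)) (t : ℝ) :
    ‖colSignal u₁ u₂ t‖ ^ 2 = ‖u₁ t‖ ^ 2 + ‖u₂ t‖ ^ 2 := by
  simp [colSignal, EuclideanSpace.norm_sq_eq, Fintype.sum_sum_type]

theorem l2Norm_sub_comm {ι : Type*} [Fintype ι] (u v : ℝ → EuclideanSpace ℝ ι) :
    l2Norm (u - v) = l2Norm (v - u) := by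
  simp [l2Norm, norm_sub_rev]

theorem IsSimilar.symm {n₁ n₂ m p : ℕ} {γ δ : ℝ} {S₁ : LinearSystem n₁ m p}
    {S₂ : LinearSystem n₂ m p} (h : IsSimilar γ δ S₁ S₂) : IsSimilar γ δ S₂ S₁ := by
  obtain ⟨ε, hε, h⟩ := h
  refine ⟨ε, hε, fun u₂ u₁ hu₂ hu₁ y₂ y₁ hy₂ hy₁ => ?_⟩
  obtain ⟨hL, hle⟩ := h u₁ u₂ hu₁ hu₂ y₁ y₂ hy₁ hy₂
  refine ⟨by simpa [IsL2Signal] using! hL.neg, ?_⟩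
  have hcol : l2Norm (colSignal u₂ u₁) = l2Norm (colSignal u₁ u₂) := by
    simp only [l2Norm, norm_sq_colSignal, add_comm]
  rwa [l2Norm_sub_comm y₂, l2Norm_sub_comm u₂, hcol]

/-! ### Zero-state responses to exponential inputs -/

namespace LinearSystem

variable {n m p : ℕ}

/-- The state matrix, acting on complex vectors. -/
noncomputable def complexA (S : LinearSystem n m p) :
    EuclideanSpace ℂ (Fin n) →L[ℂ] EuclideanSpace ℂ (Fin n) :=
  LinearMap.toContinuousLinearMap (Matrix.toEuclideanLin (S.A.map (fun a : ℝ => (a : ℂ))))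

/-- The output matrix, acting on complex vectors. -/
noncomputable def complexC (S : LinearSystem n m p) :
    EuclideanSpace ℂ (Fin n) →L[ℂ] EuclideanSpace ℂ (Fin p) :=
  LinearMap.toContinuousLinearMap (Matrix.toEuclideanLin (S.C.map (fun a : ℝ => (a : ℂ))))

/-- The amplitude `ξ = (s I - A)⁻¹ B v` of the particular state solution `e^{st} ξ` for the input
`e^{st} v`. -/
noncomputable def stateAmplitude (S : LinearSystem n m p) (s : ℂ) (v : EuclideanSpace ℂ (Fin m)) :
    EuclideanSpace ℂ (Fin n) :=
  Matrix.toEuclideanLin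
    ((s • (1 : Matrix (Fin n) (Fin n) ℂ) - S.A.map (fun a : ℝ => (a : ℂ)))⁻¹ *
      S.B.map (fun a : ℝ => (a : ℂ))) v

/-- The free response `C e^{tA} ξ`: the zero-state response to `e^{st} v` is `e^{st} G(s) v` minus
this term. -/
noncomputable def transient (S : LinearSystem n m p) (s : ℂ) (v : EuclideanSpace ℂ (Fin m))
    (t : ℝ) : EuclideanSpace ℂ (Fin p) :=
  S.complexC (NormedSpace.exp ((t : ℂ) • S.complexA) (S.stateAmplitude s v))

theorem complexC_stateAmplitude (S : LinearSystem n m p) (s : ℂ) (v : EuclideanSpace ℂ (Fin m)) :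
    S.complexC (S.stateAmplitude s v) = Matrix.toEuclideanLin (S.transferMatrix s) v := by
  simp [complexC, stateAmplitude, transferMatrix, Matrix.toLpLin_apply, Matrix.mul_assoc]

theorem smul_stateAmplitude (S : LinearSystem n m p) {s : ℂ}
    (hs : IsUnit (s • (1 : Matrix (Fin n) (Fin n) ℂ) - S.A.map (fun a : ℝ => (a : ℂ))).det)
    (v : EuclideanSpace ℂ (Fin m)) :
    s • S.stateAmplitude s v = S.complexA (S.stateAmplitude s v) +
      Matrix.toEuclideanLin (S.B.map (fun a : ℝ => (a : ℂ))) v := by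
  have h : Matrix.toEuclideanLin
      (s • (1 : Matrix (Fin n) (Fin n) ℂ) - S.A.map (fun a : ℝ => (a : ℂ)))
        (S.stateAmplitude s v) = Matrix.toEuclideanLin (S.B.map (fun a : ℝ => (a : ℂ))) v := by
    simp only [stateAmplitude, Matrix.toLpLin_apply, Matrix.mulVec_mulVec]
    rw [Matrix.mul_nonsing_inv_cancel_left _ _ hs]
  rw [← h, map_sub, map_smul, Matrix.toLpLin_one]
  simp [complexA]

/-- The complex trajectory is `e^{st} ξ - e^{tA} ξ`; it vanishes at `t = 0`, and its real part is a
trajectory of the real system since the system matrices are real. -/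
theorem isOutput_reVec_exp (S : LinearSystem n m p) {s : ℂ}
    (hs : IsUnit (s • (1 : Matrix (Fin n) (Fin n) ℂ) - S.A.map (fun a : ℝ => (a : ℂ))).det)
    (v : EuclideanSpace ℂ (Fin m)) :
    S.IsOutput 0 (fun t => reVec m (Complex.exp (s * t) • v))
      (fun t => reVec p (Complex.exp (s * t) • Matrix.toEuclideanLin (S.transferMatrix s) v -
        S.transient s v t)) := by
  set ξ := S.stateAmplitude s v with hξ
  set X : ℝ → EuclideanSpace ℂ (Fin n) := fun t =>
    Complex.exp (s * t) • ξ - NormedSpace.exp ((t : ℂ) • S.complexA) ξ with hX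
  have hderiv : ∀ t : ℝ, HasDerivAt X (S.complexA (X t) +
      Matrix.toEuclideanLin (S.B.map (fun a : ℝ => (a : ℂ))) (Complex.exp (s * t) • v)) t := by
    intro t
    have h1 : HasDerivAt (fun t : ℝ => Complex.exp (s * t)) (Complex.exp (s * t) * s) t := by
      have := ((Complex.ofRealCLM.hasDerivAt (x := t)).const_mul s).cexp
      simpa using this
    have h2 := hasDerivAt_exp_ofReal_smul_apply S.complexA ξ t
    convert! (h1.smul_const ξ).sub h2 using 1
    rw [mul_smul, hξ, S.smul_stateAmplitude hs, ← hξ, hX]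
    simp only [map_sub, map_smul, smul_add]
    abel
  have hXc : Continuous X := continuous_iff_continuousAt.mpr fun t => (hderiv t).continuousAt
  have hx : ∀ t : ℝ, HasDerivAt (fun t => reVec n (X t))
      (Matrix.toEuclideanLin S.A (reVec n (X t)) +
        Matrix.toEuclideanLin S.B (reVec m (Complex.exp (s * t) • v))) t := by
    intro t
    rw [← reVec_toEuclideanLin, ← reVec_toEuclideanLin, ← map_add]
    exact (reVec n).hasFDerivAt.comp_hasDerivAt t (hderiv t)
  refine ⟨fun t => reVec n (X t), ⟨((reVec n).continuous.comp hXc).continuousOn, fun t _ => ?_⟩,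
    fun t _ => ?_⟩
  · have hcont : Continuous fun t : ℝ => Matrix.toEuclideanLin S.A (reVec n (X t)) +
        Matrix.toEuclideanLin S.B (reVec m (Complex.exp (s * t) • v)) :=
      ((LinearMap.continuous_of_finiteDimensional _).comp ((reVec n).continuous.comp hXc)).add
        ((LinearMap.continuous_of_finiteDimensional _).comp
          ((reVec m).continuous.comp (by fun_prop)))
    rw [intervalIntegral.integral_eq_sub_of_hasDerivAt (fun t _ => hx t)
      (hcont.intervalIntegrable _ _)]
    have hX0 : X 0 = 0 := by
      simp only [hX]
      rw [Complex.ofReal_zero, zero_smul ℂ S.complexA, NormedSpace.exp_zero]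
      simp
    simp [hX0]
  · rw [← reVec_toEuclideanLin]
    rw [← S.complexC_stateAmplitude]
    simp [hX, transient, complexC, hξ]

end LinearSystem

/-! ### The resolvent and the transients near the imaginary axis -/

theorem IsHurwitz.isUnit_det {n : ℕ} {A : Matrix (Fin n) (Fin n) ℝ} (hA : IsHurwitz A) {s : ℂ}
    (hs : 0 ≤ s.re) :
    IsUnit (s • (1 : Matrix (Fin n) (Fin n) ℂ) - A.map (fun a : ℝ => (a : ℂ))).det := by
  by_contra h
  refine absurd (hA s ?_) (not_lt.mpr hs)
  rw [spectrum.mem_iff, Algebra.algebraMap_eq_smul_one]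
  exact fun hu => h ((Matrix.isUnit_iff_isUnit_det _).mp hu)

theorem continuous_det_smul_one_sub {n : ℕ} (M : Matrix (Fin n) (Fin n) ℂ) :
    Continuous fun s : ℂ => (s • (1 : Matrix (Fin n) (Fin n) ℂ) - M).det :=
  Continuous.matrix_det (by fun_prop)

theorem IsHurwitz.eventually_isUnit_det {n : ℕ} {A : Matrix (Fin n) (Fin n) ℝ} (hA : IsHurwitz A)
    {s₀ : ℂ} (hs₀ : 0 ≤ s₀.re) :
    ∀ᶠ s in 𝓝 s₀,
      IsUnit (s • (1 : Matrix (Fin n) (Fin n) ℂ) - A.map (fun a : ℝ => (a : ℂ))).det := by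
  simp only [isUnit_iff_ne_zero]
  exact (continuous_det_smul_one_sub _).continuousAt.eventually_ne
    (isUnit_iff_ne_zero.mp (hA.isUnit_det hs₀))

theorem IsHurwitz.continuousAt_inv {n : ℕ} {A : Matrix (Fin n) (Fin n) ℝ} (hA : IsHurwitz A)
    {s₀ : ℂ} (hs₀ : 0 ≤ s₀.re) :
    ContinuousAt (fun s : ℂ =>
      (s • (1 : Matrix (Fin n) (Fin n) ℂ) - A.map (fun a : ℝ => (a : ℂ)))⁻¹) s₀ := by
  simp only [Matrix.inv_def, Ring.inverse_eq_inv']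
  exact ((continuous_det_smul_one_sub _).continuousAt.inv₀
    (isUnit_iff_ne_zero.mp (hA.isUnit_det hs₀))).smul
    (Continuous.matrix_adjugate (by fun_prop)).continuousAt

theorem continuous_toEuclideanLin_apply {k l : ℕ} (v : EuclideanSpace ℂ (Fin l)) :
    Continuous fun M : Matrix (Fin k) (Fin l) ℂ => Matrix.toEuclideanLin M v := by
  simp only [Matrix.toLpLin_apply]
  exact (PiLp.continuous_toLp 2 _).comp (Continuous.matrix_mulVec continuous_id continuous_const)

/-- A family of error terms `R s v`, homogeneous in the direction `v` and continuous in time, which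
for all `s` near a point `iω` of the imaginary axis is dominated by one function that is
square-integrable on `[0, ∞)`. -/
structure IsTransientFamily {m p : ℕ}
    (R : ℂ → EuclideanSpace ℂ (Fin m) → ℝ → EuclideanSpace ℂ (Fin p)) : Prop where
  smul : ∀ (s c : ℂ) (v : EuclideanSpace ℂ (Fin m)) (t : ℝ), R s (c • v) t = c • R s v t
  continuous : ∀ (s : ℂ) (v : EuclideanSpace ℂ (Fin m)), Continuous (R s v)
  bound : ∀ (ω : ℝ) (v : EuclideanSpace ℂ (Fin m)), ∃ h : ℝ → ℝ,
    MemLp h 2 (volume.restrict (Set.Ici (0 : ℝ))) ∧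
      ∀ᶠ s in 𝓝 (Complex.I * (ω : ℂ)), ∀ t : ℝ, ‖R s v t‖ ≤ h t

theorem IsTransientFamily.sub {m p : ℕ}
    {R R' : ℂ → EuclideanSpace ℂ (Fin m) → ℝ → EuclideanSpace ℂ (Fin p)}
    (hR : IsTransientFamily R) (hR' : IsTransientFamily R') :
    IsTransientFamily fun s v t => R s v t - R' s v t where
  smul s c v t := by rw [hR.smul, hR'.smul, smul_sub]
  continuous s v := (hR.continuous s v).sub (hR'.continuous s v)
  bound ω v := by
    obtain ⟨h, hL, hb⟩ := hR.bound ω v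
    obtain ⟨h', hL', hb'⟩ := hR'.bound ω v
    refine ⟨fun t => h t + h' t, hL.add hL', ?_⟩
    filter_upwards [hb, hb'] with s hs hs' t
    exact (norm_sub_le _ _).trans (add_le_add (hs t) (hs' t))

theorem LinearSystem.isTransientFamily_transient {n m p : ℕ} (S : LinearSystem n m p)
    (hA : IsHurwitz S.A) : IsTransientFamily S.transient where
  smul s c v t := by simp [transient, stateAmplitude]
  continuous s v := by
    exact S.complexC.continuous.comp
      ((continuous_exp_ofReal_smul S.complexA).clm_apply continuous_const)
  bound ω v := by
    have hs₀ : 0 ≤ (Complex.I * (ω : ℂ)).re := by simp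
    have heig : ∀ μ : ℂ, Module.End.HasEigenvalue
        (S.complexA : Module.End ℂ (EuclideanSpace ℂ (Fin n))) μ → μ.re < 0 := fun μ hμ => by
      refine hA μ ?_
      rw [← Matrix.spectrum_toLpLin 2]
      exact hμ.mem_spectrum
    have hξ : ContinuousAt (fun s => S.stateAmplitude s v) (Complex.I * (ω : ℂ)) :=
      (continuous_toEuclideanLin_apply v).continuousAt.comp
        ((continuous_id.matrix_mul continuous_const).continuousAt.comp (hA.continuousAt_inv hs₀))
    refine ⟨fun t => (‖S.complexC‖ * (‖S.stateAmplitude (Complex.I * (ω : ℂ)) v‖ + 1)) *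
      ‖NormedSpace.exp ((t : ℂ) • S.complexA)‖, (memLp_two_exp_smul _ heig).norm.const_mul _, ?_⟩
    filter_upwards [hξ.norm.eventually_lt_const (lt_add_one _)] with s hs t
    calc ‖S.transient s v t‖
        ≤ ‖S.complexC‖ * (‖NormedSpace.exp ((t : ℂ) • S.complexA)‖ * ‖S.stateAmplitude s v‖) :=
          (S.complexC.le_opNorm _).trans (by gcongr; exact ContinuousLinearMap.le_opNorm _ _)
      _ ≤ ‖S.complexC‖ * (‖NormedSpace.exp ((t : ℂ) • S.complexA)‖ *
          (‖S.stateAmplitude (Complex.I * (ω : ℂ)) v‖ + 1)) := by gcongr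
      _ = _ := by ring

theorem IsHurwitz.continuousAt_transferMatrix {n m p : ℕ} {S : LinearSystem n m p}
    (hA : IsHurwitz S.A) (ω : ℝ) : ContinuousAt S.transferMatrix (Complex.I * (ω : ℂ)) :=
  ((continuous_const.matrix_mul continuous_id).matrix_mul continuous_const).continuousAt.comp
    (hA.continuousAt_inv (by simp))

/-! ### Damped exponentials -/

theorem memLp_two_cexp_smul {E : Type*} [NormedAddCommGroup E] [NormedSpace ℂ E] {s : ℂ}
    (hs : s.re < 0) (v : E) :
    MemLp (fun t : ℝ => Complex.exp (s * t) • v) 2 (volume.restrict (Set.Ici (0 : ℝ))) := by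
  simpa using! (ContinuousLinearMap.toSpanSingleton ℂ v).comp_memLp' (memLp_two_pow_mul_exp hs 0)

theorem integral_norm_sq_cexp_smul {E : Type*} [NormedAddCommGroup E] [NormedSpace ℂ E] {s : ℂ}
    (hs : s.re < 0) (v : E) :
    ∫ t in Set.Ici (0 : ℝ), ‖Complex.exp (s * t) • v‖ ^ 2 = ‖v‖ ^ 2 / (-2 * s.re) := by
  have h : ∀ t : ℝ, ‖Complex.exp (s * t) • v‖ ^ 2 = Real.exp (2 * s.re * t) * ‖v‖ ^ 2 := by
    intro t
    rw [norm_smul, mul_pow, Complex.norm_exp, ← Real.exp_nat_mul]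
    congr 2
    simp; ring
  simp_rw [h]
  rw [integral_Ici_eq_integral_Ioi, integral_mul_const, integral_exp_mul_Ioi (by linarith)]
  have : s.re ≠ 0 := hs.ne
  simp
  field_simp

/-- The triangle inequality and Young's inequality with weight `θ`. -/
theorem norm_sq_le_weighted {E : Type*} [SeminormedAddCommGroup E] (a b : E) {θ : ℝ}
    (hθ : 0 < θ) : ‖a‖ ^ 2 ≤ (1 + θ) * ‖a - b‖ ^ 2 + (1 + θ⁻¹) * ‖b‖ ^ 2 := by
  have h : ‖a‖ ≤ ‖a - b‖ + ‖b‖ := by simpa using norm_add_le (a - b) b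
  have h2 : ‖a‖ ^ 2 ≤ (‖a - b‖ + ‖b‖) ^ 2 := by gcongr
  have h3 : 0 ≤ θ⁻¹ * (θ * ‖a - b‖ - ‖b‖) ^ 2 := by positivity
  have h4 : θ⁻¹ * (θ * ‖a - b‖ - ‖b‖) ^ 2 =
      θ * ‖a - b‖ ^ 2 - 2 * ‖a - b‖ * ‖b‖ + θ⁻¹ * ‖b‖ ^ 2 := by field_simp; ring
  nlinarith

/-- Integrated form of `norm_sq_le_weighted`: the damped exponential `e^{st} w` is controlled by
its perturbation by an error `r`. The damping is `θ²` and Young's weight is `θ`, so that the factor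
`2θ² (1 + θ⁻¹)` on the energy of the error still tends to zero. -/
theorem norm_sq_le_of_integral_le {E F : Type*} [NormedAddCommGroup E] [NormedSpace ℂ E]
    [NormedAddCommGroup F] [NormedSpace ℂ F] {s : ℂ} {θ c : ℝ} (hθ : 0 < θ) (hs : s.re = -θ ^ 2)
    (v : E) (w : F) {r : ℝ → F} {h : ℝ → ℝ} (hr : Continuous r)
    (hL : MemLp h 2 (volume.restrict (Set.Ici (0 : ℝ)))) (hrh : ∀ t, ‖r t‖ ≤ h t)
    (hgain : ∫ t in Set.Ici (0 : ℝ), ‖Complex.exp (s * t) • w - r t‖ ^ 2 ≤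
      c * ∫ t in Set.Ici (0 : ℝ), ‖Complex.exp (s * t) • v‖ ^ 2) :
    ‖w‖ ^ 2 ≤ (1 + θ) * (c * ‖v‖ ^ 2) +
      2 * (θ ^ 2 + θ) * ∫ t in Set.Ici (0 : ℝ), h t ^ 2 := by
  have hs0 : s.re < 0 := by rw [hs]; nlinarith
  have hrL : MemLp r 2 (volume.restrict (Set.Ici (0 : ℝ))) :=
    hL.mono hr.aestronglyMeasurable
      (Eventually.of_forall fun t => (hrh t).trans (le_abs_self _))
  have hint1 : Integrable (fun t : ℝ => ‖Complex.exp (s * t) • w - r t‖ ^ 2)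
      (volume.restrict (Set.Ici (0 : ℝ))) :=
    ((memLp_two_cexp_smul hs0 w).sub hrL).integrable_norm_pow (by norm_num)
  have hint2 := hL.integrable_sq
  have hint3 := (memLp_two_cexp_smul hs0 w).integrable_norm_pow (by norm_num)
  have hmono : ∫ t in Set.Ici (0 : ℝ), ‖Complex.exp (s * t) • w‖ ^ 2 ≤
      ∫ t in Set.Ici (0 : ℝ), ((1 + θ) * ‖Complex.exp (s * t) • w - r t‖ ^ 2 +
        (1 + θ⁻¹) * h t ^ 2) := by
    refine integral_mono hint3 ((hint1.const_mul _).add (hint2.const_mul _)) fun t => ?_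
    refine (norm_sq_le_weighted _ (r t) hθ).trans ?_
    have := hrh t
    gcongr
  rw [integral_add (hint1.const_mul _) (hint2.const_mul _), integral_const_mul,
    integral_const_mul, integral_norm_sq_cexp_smul hs0] at hmono
  rw [integral_norm_sq_cexp_smul hs0] at hgain
  have hθ' : 0 < 1 + θ := by linarith
  have h1 := hmono.trans (add_le_add_left (mul_le_mul_of_nonneg_left hgain hθ'.le) _)
  rw [hs, div_le_iff₀ (by nlinarith)] at h1
  refine h1.trans_eq ?_
  field_simp

/-! ### From gain bounds to the `H_∞` norm -/

/-- A gain bound for the responses to damped exponentials bounds the `H_∞` norm: as the damping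
`-Re s = θ²` tends to zero, the energy of `e^{st} G(s) v` grows like `θ⁻²` and outweighs the bounded
energy of the transient. -/
theorem hInfNorm_le_of_gain {m p : ℕ} {G : ℂ → Matrix (Fin p) (Fin m) ℂ}
    {R : ℂ → EuclideanSpace ℂ (Fin m) → ℝ → EuclideanSpace ℂ (Fin p)}
    (hG : ∀ ω : ℝ, ContinuousAt G (Complex.I * (ω : ℂ))) (hR : IsTransientFamily R) {c : ℝ}
    (hgain : ∀ ω : ℝ, ∀ᶠ s in 𝓝 (Complex.I * (ω : ℂ)), s.re < 0 →
      ∀ v : EuclideanSpace ℂ (Fin m),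
        l2Norm (fun t => reVec p
          (Complex.exp (s * t) • Matrix.toEuclideanLin (G s) v - R s v t)) ^ 2 ≤
          c * l2Norm (fun t => reVec m (Complex.exp (s * t) • v)) ^ 2) :
    hInfNorm G ≤ ENNReal.ofReal √c := by
  refine iSup_le fun ω => ENNReal.ofReal_le_ofReal (singularValues_zero_le _ fun v => ?_)
  obtain ⟨h, hL, hb⟩ := hR.bound ω v
  -- the points `s = iω - θ²` approach `iω` from the left half-plane
  let σ : ℝ → ℂ := fun θ => Complex.I * (ω : ℂ) - ((θ ^ 2 : ℝ) : ℂ)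
  have hσ : Tendsto σ (𝓝[>] 0) (𝓝 (Complex.I * (ω : ℂ))) := by
    have : Continuous σ := by fun_prop
    simpa [σ] using (this.tendsto 0).mono_left nhdsWithin_le_nhds
  have hw : Tendsto (fun θ => ‖Matrix.toEuclideanLin (G (σ θ)) v‖ ^ 2) (𝓝[>] 0)
      (𝓝 (‖Matrix.toEuclideanLin (G (Complex.I * (ω : ℂ))) v‖ ^ 2)) :=
    ((((continuous_toEuclideanLin_apply v).tendsto _).comp ((hG ω).tendsto.comp hσ)).norm).pow 2
  have hlim : Tendsto (fun θ : ℝ => (1 + θ) * (c * ‖v‖ ^ 2) +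
      2 * (θ ^ 2 + θ) * ∫ t in Set.Ici (0 : ℝ), h t ^ 2) (𝓝[>] 0) (𝓝 (c * ‖v‖ ^ 2)) := by
    have : Continuous fun θ : ℝ => (1 + θ) * (c * ‖v‖ ^ 2) +
      2 * (θ ^ 2 + θ) * ∫ t in Set.Ici (0 : ℝ), h t ^ 2 := by fun_prop
    simpa using (this.tendsto 0).mono_left nhdsWithin_le_nhds
  refine le_of_tendsto_of_tendsto hw hlim ?_
  filter_upwards [hσ.eventually hb, hσ.eventually (hgain ω), self_mem_nhdsWithin] with θ hbθ hgθ hθ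
  have hθ0 : 0 < θ := hθ
  have hre : (σ θ).re = -θ ^ 2 := by
    simp only [σ, Complex.sub_re, Complex.ofReal_re]
    simp
  have hre0 : (σ θ).re < 0 := by rw [hre]; nlinarith
  refine norm_sq_le_of_integral_le hθ0 hre v _ (hR.continuous _ v) hL hbθ ?_
  set Y : ℝ → EuclideanSpace ℂ (Fin p) := fun t =>
    Complex.exp (σ θ * t) • Matrix.toEuclideanLin (G (σ θ)) v - R (σ θ) v t with hY
  have hYL : MemLp Y 2 (volume.restrict (Set.Ici (0 : ℝ))) :=
    (memLp_two_cexp_smul hre0 _).sub (hL.mono (hR.continuous _ v).aestronglyMeasurable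
      (Eventually.of_forall fun t => (hbθ t).trans (le_abs_self _)))
  -- the gain bound for complex signals is the sum of those for their real and imaginary parts
  have hsplit : ∀ {k : ℕ} {f : ℝ → EuclideanSpace ℂ (Fin k)},
      MemLp f 2 (volume.restrict (Set.Ici (0 : ℝ))) →
      ∫ t in Set.Ici (0 : ℝ), ‖f t‖ ^ 2 = l2Norm (fun t => reVec k (f t)) ^ 2 +
        l2Norm (fun t => reVec k ((-Complex.I) • f t)) ^ 2 := by
    intro k f hf
    have h₁ := ((reVec k).comp_memLp' hf).integrable_norm_pow two_ne_zero
    have h₂ := ((reVec k).comp_memLp' (hf.const_smul (-Complex.I))).integrable_norm_pow two_ne_zero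
    rw [sq_l2Norm, sq_l2Norm]
    refine Eq.trans ?_ (integral_add h₁ h₂)
    simp_rw [norm_sq_eq_reVec]
  rw [hsplit hYL, hsplit (memLp_two_cexp_smul hre0 v), mul_add]
  refine add_le_add (hgθ hre0 v) ?_
  have := hgθ hre0 ((-Complex.I) • v)
  simp only [map_smul, hR.smul, smul_comm _ (-Complex.I), ← smul_sub] at this
  simpa only [hY] using this

/-! ### Consequences of similarity -/

theorem isL2Signal_reVec_cexp {k : ℕ} {s : ℂ} (hs : s.re < 0) (v : EuclideanSpace ℂ (Fin k)) :
    IsL2Signal fun t => reVec k (Complex.exp (s * t) • v) :=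
  (reVec k).comp_memLp' (memLp_two_cexp_smul hs v)

theorem LinearSystem.isOutput_zero {n m p : ℕ} (S : LinearSystem n m p) : S.IsOutput 0 0 0 :=
  ⟨0, ⟨continuousOn_const, fun t _ => by simp⟩, fun t _ => by simp⟩

theorem ofReal_sqrt_lt_ofReal_sqrt {x y : ℝ} (hy : 0 < y) (h : x < y) :
    ENNReal.ofReal √x < ENNReal.ofReal √y :=
  (ENNReal.ofReal_lt_ofReal_iff (Real.sqrt_pos.mpr hy)).mpr
    ((Real.sqrt_lt_sqrt_iff_of_pos hy).mpr h)

/-- The input `u₂ = 0` turns similarity into a gain bound for `S₁` alone. -/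
theorem IsSimilar.hInfNorm_left_lt {n₁ n₂ m p : ℕ} {γ δ : ℝ} {S₁ : LinearSystem n₁ m p}
    {S₂ : LinearSystem n₂ m p} (hA₁ : IsHurwitz S₁.A) (hγδ : 0 < γ + δ)
    (h : IsSimilar γ δ S₁ S₂) : hInfNorm S₁.transferMatrix < ENNReal.ofReal √(γ + δ) := by
  obtain ⟨ε, hε, h⟩ := h
  refine lt_of_le_of_lt (hInfNorm_le_of_gain (c := γ + δ - ε)
    (fun ω => hA₁.continuousAt_transferMatrix ω) (S₁.isTransientFamily_transient hA₁) fun ω => ?_)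
    (ofReal_sqrt_lt_ofReal_sqrt hγδ (by linarith))
  filter_upwards [hA₁.eventually_isUnit_det (s₀ := Complex.I * (ω : ℂ)) (by simp)] with s hs hre v
  have hle := (h _ 0 (isL2Signal_reVec_cexp hre v) MemLp.zero _ 0 (S₁.isOutput_reVec_exp hs v)
    S₂.isOutput_zero).2
  simp only [sub_zero] at hle
  refine hle.trans_eq ?_
  simp only [sq_l2Norm, norm_sq_colSignal]
  simp
  ring

/-- Equal inputs `u₁ = u₂` turn similarity into a gain bound for the error system. -/
theorem IsSimilar.hInfNorm_sub_lt {n₁ n₂ m p : ℕ} {γ δ : ℝ} {S₁ : LinearSystem n₁ m p}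
    {S₂ : LinearSystem n₂ m p} (hA₁ : IsHurwitz S₁.A) (hA₂ : IsHurwitz S₂.A) (hδ : 0 < δ)
    (h : IsSimilar γ δ S₁ S₂) :
    hInfNorm (S₁.transferMatrix - S₂.transferMatrix) < ENNReal.ofReal √(2 * δ) := by
  obtain ⟨ε, hε, h⟩ := h
  refine lt_of_le_of_lt (hInfNorm_le_of_gain (c := 2 * (δ - ε))
    (fun ω => (hA₁.continuousAt_transferMatrix ω).sub (hA₂.continuousAt_transferMatrix ω))
    ((S₁.isTransientFamily_transient hA₁).sub (S₂.isTransientFamily_transient hA₂)) fun ω => ?_)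
    (ofReal_sqrt_lt_ofReal_sqrt (by linarith) (by linarith))
  filter_upwards [hA₁.eventually_isUnit_det (s₀ := Complex.I * (ω : ℂ)) (by simp),
    hA₂.eventually_isUnit_det (s₀ := Complex.I * (ω : ℂ)) (by simp)] with s hs₁ hs₂ hre v
  have hle := (h _ _ (isL2Signal_reVec_cexp hre v) (isL2Signal_reVec_cexp hre v) _ _
    (S₁.isOutput_reVec_exp hs₁ v) (S₂.isOutput_reVec_exp hs₂ v)).2
  convert! hle using 1
  · congr 2
    ext1 t
    simp only [Pi.sub_apply]
    rw [← map_sub (reVec p), map_sub Matrix.toEuclideanLin, LinearMap.sub_apply, smul_sub]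
    congr 1
    abel
  · simp only [sq_l2Norm, norm_sq_colSignal, ← two_mul, integral_const_mul]
    simp
    ring

theorem mainTheorem5 {n₁ n₂ m p : ℕ} (S₁ : LinearSystem n₁ m p) (S₂ : LinearSystem n₂ m p)
    (hA₁ : IsHurwitz S₁.A) (hA₂ : IsHurwitz S₂.A) (γ δ : ℝ) (hγ : 0 < γ) (hδ : 0 < δ) :
    (IsSimilar γ δ S₁ S₂ ↔ IsSimilar γ δ S₂ S₁) ∧
      (IsSimilar γ δ S₁ S₂ →
        (hInfNorm S₁.transferMatrix < ENNReal.ofReal √(γ + δ) ∧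
          hInfNorm S₂.transferMatrix < ENNReal.ofReal √(γ + δ)) ∧
        hInfNorm (S₁.transferMatrix - S₂.transferMatrix) < ENNReal.ofReal √(2 * δ)) :=
  ⟨⟨IsSimilar.symm, IsSimilar.symm⟩, fun h =>
    ⟨⟨h.hInfNorm_left_lt hA₁ (add_pos hγ hδ), h.symm.hInfNorm_left_lt hA₂ (add_pos hγ hδ)⟩,
      h.hInfNorm_sub_lt hA₁ hA₂ hδ⟩⟩
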